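/- Let $\epsilon\in(0,\frac16)$ be a real number, and write $\{x\}=x-\lfloor x\rfloor$ for the fractional part of $x$. Then there exist a finite set $\Gamma_0$ of positive integers and a positive integer $M$, both depending only on $\epsilon$, such that the following holds. Let $r$ be a positive integer and let $a_1,a_2,a_3,a_4,e$ be integers such that: - $\gcd(a_1,r)=\gcd(a_2,r)=\gcd(a_3,r)=1$ and $\gcd(a_4,r)=\gcd(e,r)$; - $a_1+a_2+a_3+a_4-e\equiv 1 \pmod r$; - at least one of the following holds: (i) $a_1+a_2-e\equiv 0\pmod r$; (ii) $2a_4-e\equiv 0\pmod r$; (iii) $2a_1-e\equiv 0\pmod r$ and $\gcd(a_4,r)=\gcd(e,r)\le 2$. Let $\Gamma\subseteq\{1,\dots,r-1\}$ be a non-empty set such that for every $k\in\Gamma$ $$\frac kr\in\Big[\frac56+\epsilon,1\Big)\quad\text{and}\quad \sum_{i=1}^4\Big\{\frac{a_ik}{r}\Big\}=\Big\{\frac{ek}{r}\Big\}+\frac kr,$$ and for every $k\in\{1,\dots,r-1\}\setminus\Gamma$ $$\sum_{i=1}^4\Big\{\frac{a_ik}{r}\Big\}>\Big\{\frac{ek}{r}\Big\}+1.$$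 Then either $r\in\Gamma_0$, or all of the following hold: 1. $2a_4-e\equiv 0\pmod r$ and $a_1+a_2-e\not\equiv 0\pmod r$; 2. $7\le\gcd(e,r)\le M$; 3. $r\mid ek$ for every $k\in\Gamma$. -/

import Mathlib

/-!
Put `x = (a₁, a₂, a₃, a₄, -e, -1) / r` in the torus `(ℝ/ℤ)⁶` and let `S` be the sum of the sawtooths
of the coordinates. For `0 < k < r` the gcd conditions make `S (k • x)` equal to
`∑ {aᵢ k / r} - {e k / r} - k / r - 1`, an integer that is nonnegative outside `Γ` and equals `-1`
on `Γ`. Hence `S (k • x) ≥ 0` whenever `{-k / r}` avoids `[0, 1/6 - ε]`.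

Suppose that this happened for unboundedly large `r`. Along an ultrafilter, the cyclic groups
generated by the points `x` converge to the closed subgroup `H` of the torus cut out by the integral
relations that hold in the limit (Kronecker), and the inequality passes to `H`. As `r` is unbounded,
`H` contains a one-parameter subgroup along which the last coordinate moves. Averaging `S` over
finite groups of translations, the distribution relation `∑ saw (x + i / n) = saw (n x)` yields a
combination of functions `saw (P s)`. It vanishes for `s ∈ [1/6, 5/6]`, because there both signs of
the inequality apply. Every order `n ≥ 2` is attained by a point of `[1/6, 5/6]`, so comparing jumps
shows that all coefficients cancel. Hence the nonnegative terms of the average vanish, in particular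
`S (-k • x) = 0` for `k ∈ Γ`, and `S (k • x) = -1` is impossible since `S` is odd.
-/

open Filter Finset Topology

/-- The sawtooth `((x))` on `ℝ/ℤ`: `t - 1/2` for `0 < t < 1`, with the value `0` at the jump, so
that it is odd. -/
noncomputable def saw (x : UnitAddCircle) : ℝ :=
  if x = 0 then 0 else (AddCircle.equivIco 1 0 x : ℝ) - 1 / 2

section Saw

@[simp]
theorem saw_zero : saw 0 = 0 := if_pos rfl

theorem saw_coe {t : ℝ} (ht : (t : UnitAddCircle) ≠ 0) : saw t = Int.fract t - 1 / 2 := by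
  have h : AddCircle.equivIco 1 0 (t : UnitAddCircle) = Int.fract t := by
    simp [AddCircle.coe_equivIco_mk_apply]
  rw [saw, if_neg ht, h]

theorem saw_coe_of_mem_Ioo {t : ℝ} (ht : t ∈ Set.Ioo 0 1) : saw t = t - 1 / 2 := by
  have h0 : (t : UnitAddCircle) ≠ 0 :=
    (AddCircle.coe_eq_zero_iff_of_mem_Ico ⟨ht.1.le, ht.2⟩).not.2 ht.1.ne'
  rw [saw_coe h0, Int.fract_eq_self.2 ⟨ht.1.le, ht.2⟩]

theorem exists_mem_Ioo_coe_eq {x : UnitAddCircle} (hx : x ≠ 0) :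
    ∃ t ∈ Set.Ioo (0 : ℝ) 1, (t : UnitAddCircle) = x := by
  obtain ⟨t, ht, rfl⟩ := AddCircle.eq_coe_Ico x
  exact ⟨t, ⟨ht.1.lt_of_ne' fun h ↦ hx (by simp [h]), ht.2⟩, rfl⟩

theorem neg_coe_eq_coe_one_sub (t : ℝ) : -(t : UnitAddCircle) = ((1 - t : ℝ) : UnitAddCircle) := by
  rw [AddCircle.coe_sub, AddCircle.coe_period, zero_sub]

theorem saw_neg (x : UnitAddCircle) : saw (-x) = -saw x := by
  obtain rfl | hx := eq_or_ne x 0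
  · simp
  obtain ⟨t, ht, rfl⟩ := exists_mem_Ioo_coe_eq hx
  rw [neg_coe_eq_coe_one_sub, saw_coe_of_mem_Ioo ht,
    saw_coe_of_mem_Ioo ⟨by linarith [ht.2], by linarith [ht.1]⟩]
  ring

theorem eventually_saw_add {x : UnitAddCircle} (hx : x ≠ 0) :
    ∀ᶠ t : ℝ in 𝓝 0, saw (x + t) = saw x + t := by
  obtain ⟨s, hs, rfl⟩ := exists_mem_Ioo_coe_eq hx
  have h : ∀ᶠ t : ℝ in 𝓝 0, s + t ∈ Set.Ioo (0 : ℝ) 1 :=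
    (continuous_const.add continuous_id).tendsto' 0 s (add_zero s) (isOpen_Ioo.mem_nhds hs)
  filter_upwards [h] with t ht
  rw [← AddCircle.coe_add, saw_coe_of_mem_Ioo ht, saw_coe_of_mem_Ioo hs]
  ring

theorem continuousAt_saw {x : UnitAddCircle} (hx : x ≠ 0) : ContinuousAt saw x := by
  have h : ContinuousAt (fun y : UnitAddCircle ↦ (AddCircle.equivIco 1 0 y : ℝ) - 1 / 2) x :=
    (continuous_subtype_val.continuousAt.comp (AddCircle.continuousAt_equivIco 1 0 hx)).sub
      continuousAt_const
  refine h.congr ?_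
  filter_upwards [isOpen_ne.mem_nhds hx] with y hy
  exact (if_neg hy).symm

theorem eventually_saw_add_add_saw_sub (x : UnitAddCircle) :
    ∀ᶠ t : ℝ in 𝓝 0, saw (x + t) + saw (x - t) = 2 * saw x := by
  obtain rfl | hx := eq_or_ne x 0
  · simp [saw_neg]
  have h := eventually_saw_add hx
  have h' : ∀ᶠ t : ℝ in 𝓝 0, saw (x + (-t : ℝ)) = saw x + -t :=
    (continuous_neg.tendsto' (0 : ℝ) 0 neg_zero).eventually h
  filter_upwards [h, h'] with t ht ht'
  rw [ht, sub_eq_add_neg, ← AddCircle.coe_neg, ht']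
  ring

theorem eventually_saw_add_sub_saw_sub (x : UnitAddCircle) :
    ∀ᶠ t : ℝ in 𝓝[>] 0, saw (x + t) - saw (x - t) = 2 * t - if x = 0 then 1 else 0 := by
  split_ifs with hx
  · subst hx
    filter_upwards [Ioo_mem_nhdsGT one_pos] with t ht
    rw [zero_add, zero_sub, saw_neg, saw_coe_of_mem_Ioo ht]
    ring
  · have h := eventually_saw_add hx
    have h' := eventually_saw_add_add_saw_sub x
    filter_upwards [nhdsWithin_le_nhds h, nhdsWithin_le_nhds h'] with t ht ht'
    linarith

end Saw

section Distribution

theorem eventually_saw_nsmul_add_add_saw_nsmul_sub (n : ℕ) (x : UnitAddCircle) :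
    ∀ᶠ t : ℝ in 𝓝 0, saw (n • (x + t)) + saw (n • (x - t)) = 2 * saw (n • x) := by
  have h : Tendsto (fun t : ℝ ↦ n • t) (𝓝 0) (𝓝 0) :=
    (continuous_const_smul n).tendsto' 0 0 (smul_zero n)
  filter_upwards [h.eventually (eventually_saw_add_add_saw_sub (n • x))] with t ht
  rwa [AddCircle.coe_nsmul, ← smul_add, ← smul_sub] at ht

theorem eventually_saw_nsmul_add_sub_saw_nsmul_sub {n : ℕ} (hn : 0 < n) (x : UnitAddCircle) :
    ∀ᶠ t : ℝ in 𝓝[>] 0,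
      saw (n • (x + t)) - saw (n • (x - t)) = 2 * (n * t) - if n • x = 0 then 1 else 0 := by
  have h : Tendsto (fun t : ℝ ↦ n • t) (𝓝[>] 0) (𝓝[>] 0) := by
    refine tendsto_nhdsWithin_iff.2 ⟨?_, ?_⟩
    · exact ((continuous_const_smul n).tendsto' 0 0 (smul_zero n)).mono_left nhdsWithin_le_nhds
    · filter_upwards [self_mem_nhdsWithin] with t ht using nsmul_pos (Set.mem_Ioi.1 ht) hn.ne'
  filter_upwards [h.eventually (eventually_saw_add_sub_saw_sub (n • x))] with t ht
  rwa [AddCircle.coe_nsmul, ← smul_add, ← smul_sub, nsmul_eq_mul] at ht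

theorem eq_zero_of_odd_of_no_jump {F : UnitAddCircle → ℝ} (hodd : ∀ x, F (-x) = -F x)
    (hsymm : ∀ x, ∀ᶠ t : ℝ in 𝓝 0, F (x + t) + F (x - t) = 2 * F x)
    (hjump : ∀ x, ∀ᶠ t : ℝ in 𝓝[>] 0, F (x + t) = F (x - t)) (x : UnitAddCircle) : F x = 0 := by
  have hloc (s : ℝ) : ∀ᶠ t : ℝ in 𝓝 0, F (s + t) = F s := by
    have hpos : ∀ᶠ t : ℝ in 𝓝[>] 0, F (s + t) = F s ∧ F (s - t) = F s := by
      filter_upwards [nhdsWithin_le_nhds (hsymm s), hjump s] with t h h'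
      constructor <;> linarith
    rw [← nhdsNE_sup_pure, ← nhdsLT_sup_nhdsGT, eventually_sup, eventually_sup, eventually_pure]
    refine ⟨⟨?_, hpos.mono fun t ht ↦ ht.1⟩, by simp⟩
    have hneg : Tendsto (fun t : ℝ ↦ -t) (𝓝[<] 0) (𝓝[>] 0) := by
      simpa using tendsto_neg_nhdsLT (a := (0 : ℝ))
    filter_upwards [hneg.eventually hpos] with t ht
    simpa using ht.2
  have hF : IsLocallyConstant (fun t : ℝ ↦ F t) := by
    refine (IsLocallyConstant.iff_eventually_eq _).2 fun s ↦ ?_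
    have hsub : Tendsto (fun t : ℝ ↦ t - s) (𝓝 s) (𝓝 0) :=
      (continuous_sub_right s).tendsto' s 0 (sub_self s)
    filter_upwards [hsub.eventually (hloc s)] with t ht
    rwa [← AddCircle.coe_add, add_sub_cancel] at ht
  obtain ⟨s, rfl⟩ := QuotientAddGroup.mk_surjective x
  have h := hF.apply_eq_of_isPreconnected isPreconnected_univ (Set.mem_univ s) (Set.mem_univ (-s))
  rw [AddCircle.coe_neg, hodd] at h
  exact self_eq_neg.1 h

theorem card_nsmul_eq_zero_iff_mem (B : AddSubgroup UnitAddCircle) [Finite B]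
    {x : UnitAddCircle} : Nat.card B • x = 0 ↔ x ∈ B := by
  have hfin : {u : UnitAddCircle | Nat.card B • u = 0}.Finite :=
    AddCircle.finite_torsion 1 Nat.card_pos
  have hsub : (B : Set UnitAddCircle) ⊆ {u | Nat.card B • u = 0} := fun b hb ↦
    congrArg Subtype.val (card_nsmul_eq_zero' (x := (⟨b, hb⟩ : B)))
  have hcard : {u : UnitAddCircle | Nat.card B • u = 0}.encard
      ≤ (B : Set UnitAddCircle).encard := by
    rw [← Set.Finite.cast_ncard_eq (Set.toFinite (B : Set UnitAddCircle)), ← Nat.card_coe_set_eq]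
    exact AddCircle.card_torsion_le_of_isSMulRegular 1 _ Nat.card_pos.ne'
      (.of_right_eq_zero_of_smul fun _ ↦ (nsmul_eq_zero_iff_right Nat.card_pos.ne').1)
  exact (Set.ext_iff.1 (hfin.eq_of_subset_of_encard_le' hsub hcard) x).symm

theorem sum_ite_add_eq_zero (B : AddSubgroup UnitAddCircle) [Fintype B] (x : UnitAddCircle) :
    ∑ b : B, (if x + b = 0 then (1 : ℝ) else 0) = if Nat.card B • x = 0 then 1 else 0 := by
  split_ifs with hx <;> rw [card_nsmul_eq_zero_iff_mem] at hx
  · rw [sum_eq_single_of_mem (⟨-x, B.neg_mem hx⟩ : B) (mem_univ _), if_pos (by simp)]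
    exact fun b _ hb ↦ if_neg fun h ↦ hb (Subtype.ext (eq_neg_of_add_eq_zero_right h))
  · refine sum_eq_zero fun b _ ↦ if_neg fun h ↦ hx ?_
    exact eq_neg_of_add_eq_zero_left h ▸ B.neg_mem b.2

/-- Both sides have the same slope and the same jumps, so their difference is constant; being odd,
it vanishes. -/
theorem sum_saw_add_eq_saw_card_nsmul (B : AddSubgroup UnitAddCircle) [Fintype B]
    (x : UnitAddCircle) : ∑ b : B, saw (x + b) = saw (Nat.card B • x) := by
  set F : UnitAddCircle → ℝ := fun x ↦ ∑ b : B, saw (x + b) - saw (Nat.card B • x) with hF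
  suffices F x = 0 from sub_eq_zero.1 this
  refine eq_zero_of_odd_of_no_jump (fun x ↦ ?_) (fun x ↦ ?_) (fun x ↦ ?_) x
  · simp only [hF, smul_neg, saw_neg]
    rw [← Equiv.sum_comp (Equiv.neg B)]
    simp only [Equiv.neg_apply, NegMemClass.coe_neg, ← neg_add, saw_neg, sum_neg_distrib]
    ring
  · filter_upwards [eventually_all.2 fun b : B ↦ eventually_saw_add_add_saw_sub (x + b),
      eventually_saw_nsmul_add_add_saw_nsmul_sub (Nat.card B) x] with t hb hB
    have h := sum_congr rfl fun b (_ : b ∈ univ) ↦ hb b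
    rw [sum_add_distrib, ← mul_sum] at h
    simp only [hF, add_right_comm x _ _, sub_add_eq_add_sub x _ _]
    linarith
  · filter_upwards [eventually_all.2 fun b : B ↦ eventually_saw_add_sub_saw_sub (x + b),
      eventually_saw_nsmul_add_sub_saw_nsmul_sub (n := Nat.card B) Nat.card_pos x] with t hb hB
    have h := sum_congr rfl fun b (_ : b ∈ univ) ↦ hb b
    rw [sum_sub_distrib, sum_sub_distrib, sum_ite_add_eq_zero, sum_const,
      card_univ, ← Nat.card_eq_fintype_card, nsmul_eq_mul] at h
    simp only [hF, add_right_comm x _ _, sub_add_eq_add_sub x _ _]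
    linarith

theorem sum_saw_add_apply {A : Type*} [AddGroup A] [Fintype A] (f : A →+ UnitAddCircle)
    (x : UnitAddCircle) :
    ∑ a, saw (x + f a) = Nat.card f.ker * saw (Nat.card f.range • x) := by
  classical
  have hcard (b : f.range) : #{a | f.rangeRestrict a = b} = Nat.card f.ker := by
    have hker : Nat.card f.ker = #{a | f a = 0} :=
      Nat.subtype_card _ fun a ↦ by simp [AddMonoidHom.mem_ker]
    rw [hker, ← AddMonoidHom.card_fiber_eq_of_mem_range f b.2 ⟨0, map_zero f⟩]
    exact congrArg card (filter_congr fun a _ ↦ Subtype.ext_iff)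
  calc ∑ a, saw (x + f a) = ∑ a, saw (x + f.rangeRestrict a) := rfl
    _ = ∑ b : f.range, #{a | f.rangeRestrict a = b} • saw (x + b) := by
      rw [← sum_fiberwise' univ f.rangeRestrict fun b : f.range ↦ saw (x + b)]
      simp only [sum_const]
    _ = Nat.card f.ker * saw (Nat.card f.range • x) := by
      simp only [hcard]
      rw [← smul_sum, sum_saw_add_eq_saw_card_nsmul, nsmul_eq_mul]

end Distribution

section Combination

theorem exists_coprime_le_six_mul_le {n : ℕ} (hn : 2 ≤ n) :
    ∃ a : ℕ, a.Coprime n ∧ n ≤ 6 * a ∧ 6 * a ≤ 5 * n := by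
  obtain ⟨m, rfl | rfl⟩ := n.even_or_odd'
  · obtain ⟨l, rfl | rfl⟩ := m.even_or_odd'
    · refine ⟨2 * l - 1, ?_, by omega, by omega⟩
      have h : 2 * (2 * l) = 2 * (2 * l - 1) + 2 := by omega
      rw [h, Nat.coprime_mul_right_add_right]
      exact Nat.coprime_two_right.2 ⟨l - 1, by omega⟩
    · obtain rfl | hl := l.eq_zero_or_pos
      · exact ⟨1, by simp, by omega, by omega⟩
      · refine ⟨2 * l - 1, ?_, by omega, by omega⟩
        have h : 2 * (2 * l + 1) = 2 * (2 * l - 1) + 2 ^ 2 := by omega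
        rw [h, Nat.coprime_mul_right_add_right]
        exact (Nat.coprime_two_right.2 ⟨l - 1, by omega⟩).pow_right 2
  · refine ⟨m, ?_, by omega, by omega⟩
    rw [Nat.coprime_mul_right_add_right]
    exact Nat.coprime_one_right m

theorem exists_addOrderOf_eq_coe_mem_Icc {n : ℕ} (hn : 2 ≤ n) :
    ∃ t ∈ Set.Icc (1 / 6 : ℝ) (5 / 6), addOrderOf (t : UnitAddCircle) = n := by
  obtain ⟨a, hcop, hle, hle'⟩ := exists_coprime_le_six_mul_le hn
  have hpos : (0 : ℝ) < n := by positivity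
  refine ⟨a / n, ⟨?_, ?_⟩, ?_⟩
  · rw [div_le_div_iff₀ (by norm_num) hpos]
    exact_mod_cast (by omega : 1 * n ≤ a * 6)
  · rw [div_le_div_iff₀ hpos (by norm_num)]
    exact_mod_cast (by omega : a * 6 ≤ 5 * n)
  · simpa using AddCircle.addOrderOf_div_of_gcd_eq_one (p := (1 : ℝ)) (by omega) hcop

variable {ι : Type*} {J : Finset ι} {D : ι → ℝ} {P : ι → ℕ}

theorem sum_eq_zero_of_sum_saw_nsmul_eq_zero {S : Set UnitAddCircle} (hS : IsOpen S)
    (h : ∀ s ∈ S, ∑ j ∈ J, D j * saw (P j • s) = 0) {x : UnitAddCircle} (hx : x ∈ S)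
    (hfin : IsOfFinAddOrder x) (hP : ∀ j ∈ J, P j ≤ addOrderOf x) :
    ∑ j ∈ J with P j = addOrderOf x, D j = 0 := by
  have hjump (j) (hj : j ∈ J) : ∀ᶠ t : ℝ in 𝓝[>] 0,
      saw (P j • (x + t)) - saw (P j • (x - t))
        = 2 * (P j * t) - if P j = addOrderOf x then 1 else 0 := by
    obtain h0 | hpos := (P j).eq_zero_or_pos
    · exact .of_forall fun t ↦ by simp [h0, hfin.addOrderOf_pos.ne]
    · have hiff : P j • x = 0 ↔ P j = addOrderOf x := by
        rw [← addOrderOf_dvd_iff_nsmul_eq_zero]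
        exact ⟨fun hdvd ↦ (hP j hj).antisymm (Nat.le_of_dvd hpos hdvd), fun he ↦ he ▸ dvd_rfl⟩
      simpa only [hiff] using eventually_saw_nsmul_add_sub_saw_nsmul_sub hpos x
  have hadd : ∀ᶠ t : ℝ in 𝓝 0, x + t ∈ S :=
    (continuous_const.add (AddCircle.continuous_mk' 1)).tendsto' 0 x (add_zero x) (hS.mem_nhds hx)
  have hsub : ∀ᶠ t : ℝ in 𝓝 0, x - t ∈ S :=
    (continuous_const.sub (AddCircle.continuous_mk' 1)).tendsto' 0 x (sub_zero x) (hS.mem_nhds hx)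
  have hzero : ∀ᶠ t : ℝ in 𝓝[>] 0,
      2 * (∑ j ∈ J, D j * P j) * t = ∑ j ∈ J with P j = addOrderOf x, D j := by
    filter_upwards [(eventually_all_finset J).2 hjump, nhdsWithin_le_nhds hadd,
      nhdsWithin_le_nhds hsub] with t ht hadd hsub
    have hdiff := congrArg₂ (· - ·) (h _ hadd) (h _ hsub)
    simp only [← sum_sub_distrib, ← mul_sub, sub_self] at hdiff
    rw [sum_congr rfl fun j hj ↦ congrArg (D j * ·) (ht j hj)] at hdiff
    simp only [mul_sub, mul_ite, mul_one, mul_zero, sum_sub_distrib, ← sum_filter] at hdiff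
    rw [← sub_eq_zero, ← hdiff, mul_sum, sum_mul]
    exact congrArg (· - _) (sum_congr rfl fun j _ ↦ by ring)
  have hlim : Tendsto (fun t : ℝ ↦ 2 * (∑ j ∈ J, D j * P j) * t) (𝓝[>] 0) (𝓝 0) :=
    ((continuous_const_mul _).tendsto' 0 0 (mul_zero _)).mono_left nhdsWithin_le_nhds
  exact tendsto_nhds_unique (tendsto_const_nhds.congr' (hzero.mono fun _ ↦ Eq.symm)) hlim

theorem sum_saw_nsmul_eq_zero_of_middle {S : Set UnitAddCircle} (hS : IsOpen S)
    (hmid : ∀ t ∈ Set.Icc (1 / 6 : ℝ) (5 / 6), (t : UnitAddCircle) ∈ S)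
    (h : ∀ s ∈ S, ∑ j ∈ J, D j * saw (P j • s) = 0) (s : UnitAddCircle) :
    ∑ j ∈ J, D j * saw (P j • s) = 0 := by
  obtain ⟨n, hn⟩ : ∃ n, ∀ j ∈ J, P j ≤ n := ⟨J.sup P, fun j ↦ le_sup⟩
  induction n generalizing J with
  | zero => exact sum_eq_zero fun j hj ↦ by simp [Nat.le_zero.1 (hn j hj)]
  | succ n ih =>
    have hsplit (s : UnitAddCircle) : ∑ j ∈ J, D j * saw (P j • s)
        = (∑ j ∈ J with P j = n + 1, D j) * saw ((n + 1) • s)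
          + ∑ j ∈ J with P j ≠ n + 1, D j * saw (P j • s) := by
      rw [← sum_filter_add_sum_filter_not J (fun j ↦ P j = n + 1), sum_mul]
      congr 1
      exact sum_congr rfl fun j hj ↦ by rw [(mem_filter.1 hj).2]
    have hlt : ∀ j ∈ J.filter (P · ≠ n + 1), P j ≤ n := fun j hj ↦ by
      have := hn j (mem_filter.1 hj).1
      have := (mem_filter.1 hj).2
      omega
    have hD : ∑ j ∈ J with P j = n + 1, D j = 0 := by
      obtain rfl | hpos := n.eq_zero_or_pos
      · have hthird := h _ (hmid (1 / 3) ⟨by norm_num, by norm_num⟩)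
        have hrest :
            ∑ j ∈ J with P j ≠ 0 + 1, D j * saw (P j • ((1 / 3 : ℝ) : UnitAddCircle)) = 0 :=
          sum_eq_zero fun j hj ↦ by simp [Nat.le_zero.1 (hlt j hj)]
        rw [hsplit, hrest, add_zero, zero_add, one_smul,
          saw_coe_of_mem_Ioo ⟨by norm_num, by norm_num⟩] at hthird
        exact (mul_eq_zero.1 hthird).resolve_right (by norm_num)
      · obtain ⟨t, ht, hord⟩ := exists_addOrderOf_eq_coe_mem_Icc (n := n + 1) (by omega)
        have hn' : ∀ j ∈ J, P j ≤ addOrderOf (t : UnitAddCircle) := by rwa [hord]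
        simpa [hord] using sum_eq_zero_of_sum_saw_nsmul_eq_zero hS h (hmid t ht)
          (addOrderOf_pos_iff.1 (by omega)) hn'
    simp only [hsplit, hD, zero_mul, zero_add] at h ⊢
    exact ih h hlt

end Combination

section LimitSubgroup

variable {α G : Type*} [AddCommGroup G] [TopologicalSpace G] [IsTopologicalAddGroup G]
  {l : Filter α} {U : Ultrafilter α} {x : α → G}

/-- The subgroup of limits along `l` of multiples `k • x a`, where `k` may depend on `a`: the lower
limit of the cyclic groups generated by the `x a`, and their limit if `l` is an ultrafilter. -/
def multiplesLimit (l : Filter α) (x : α → G) : AddSubgroup G where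
  carrier := {y | ∀ V ∈ 𝓝 y, ∀ᶠ a in l, ∃ k : ℤ, k • x a ∈ V}
  zero_mem' V hV := .of_forall fun a ↦ ⟨0, by simpa using mem_of_mem_nhds hV⟩
  add_mem' {y z} hy hz V hV := by
    obtain ⟨V₁, hV₁, V₂, hV₂, hadd⟩ := mem_nhds_prod_iff.1 (continuous_add.tendsto (y, z) hV)
    filter_upwards [hy V₁ hV₁, hz V₂ hV₂] with a ⟨k, hk⟩ ⟨k', hk'⟩
    exact ⟨k + k', by simpa [add_smul] using hadd (Set.mk_mem_prod hk hk')⟩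
  neg_mem' {y} hy V hV := by
    filter_upwards [hy _ (continuous_neg.tendsto y hV)] with a ⟨k, hk⟩
    exact ⟨-k, by simpa using hk⟩

theorem isClosed_multiplesLimit : IsClosed (multiplesLimit l x : Set G) := by
  refine isClosed_iff_frequently.2 fun y hy V hV ↦ ?_
  obtain ⟨z, hzV, hz⟩ := ((eventually_eventually_nhds.2 hV).and_frequently hy).exists
  exact hz V hzV

theorem eventually_forall_zsmul_mem [CompactSpace G] {W : Set G}
    (hW : W ∈ 𝓝ˢ (multiplesLimit U x : Set G)) : ∀ᶠ a in U, ∀ k : ℤ, k • x a ∈ W := by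
  by_contra h
  rw [← Ultrafilter.eventually_not] at h
  simp only [not_forall] at h
  obtain ⟨k, hk⟩ := h.choice
  obtain ⟨y, -, hy⟩ := isCompact_univ.ultrafilter_le_nhds (U.map fun a ↦ k a • x a) (by simp)
  have hlim : Tendsto (fun a ↦ k a • x a) U (𝓝 y) := hy
  have hmem : y ∈ multiplesLimit U x := fun V hV ↦
    (hlim.eventually_mem hV).mono fun a ha ↦ ⟨k a, ha⟩
  have hWy : ∀ᶠ a in U, k a • x a ∈ W := hlim.eventually_mem (nhds_le_nhdsSet hmem hW)
  obtain ⟨a, ha, ha'⟩ := (hWy.and hk).exists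
  exact ha' ha

end LimitSubgroup

section Kronecker

variable {α ι : Type*} [Fintype ι]

/-- The integral linear relations `∑ j, m j • x a j = 0` that hold for almost all `a`. -/
def relations (l : Filter α) (x : α → UnitAddTorus ι) : Submodule ℤ (ι → ℤ) where
  carrier := {m | ∀ᶠ a in l, ∑ j, m j • x a j = 0}
  zero_mem' := .of_forall fun a ↦ by simp
  add_mem' {m n} hm hn := by
    filter_upwards [hm, hn] with a ha ha'
    simp [add_smul, sum_add_distrib, ha, ha']
  smul_mem' c m hm := by
    filter_upwards [hm] with a ha
    simp [mul_smul, ← smul_sum, ha]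

/-- The points of the torus that satisfy all relations in `Λ`. -/
def annihilator (Λ : Submodule ℤ (ι → ℤ)) : AddSubgroup (UnitAddTorus ι) where
  carrier := {y | ∀ m ∈ Λ, ∑ j, m j • y j = 0}
  zero_mem' m _ := by simp
  add_mem' hy hz m hm := by simp [sum_add_distrib, hy m hm, hz m hm]
  neg_mem' hy m hm := by simp [hy m hm]

variable {l : Filter α} {U : Ultrafilter α} {x : α → UnitAddTorus ι}

theorem eventually_mem_annihilator_relations :
    ∀ᶠ a in l, x a ∈ annihilator (relations l x) := by
  obtain ⟨S, hS⟩ := IsNoetherian.noetherian (relations l x)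
  have h : ∀ m ∈ S, ∀ᶠ a in l, ∑ j, m j • x a j = 0 := fun m hm ↦
    (hS ▸ Submodule.subset_span hm : m ∈ relations l x)
  filter_upwards [(eventually_all_finset S).2 h] with a ha m hm
  rw [← hS] at hm
  induction hm using Submodule.span_induction with
  | mem m hm => exact ha m hm
  | zero => simp
  | add m n _ _ hm hn => simp [add_smul, sum_add_distrib, hm, hn]
  | smul c m _ hm => simp [mul_smul, ← smul_sum, hm]

open UnitAddTorus in
theorem mFourier_eq_toCircle (m : ι → ℤ) (y : UnitAddTorus ι) :
    mFourier m y = AddCircle.toCircle (∑ j, m j • y j) := by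
  have hsum (J : Finset ι) : (AddCircle.toCircle (∑ j ∈ J, m j • y j) : ℂ)
      = ∏ j ∈ J, fourier (m j) (y j) := by
    induction J using Finset.cons_induction with
    | empty => simp
    | cons j J hj ih =>
      rw [sum_cons, prod_cons, AddCircle.toCircle_add, Circle.coe_mul, ih, fourier_apply]
  exact (hsum univ).symm

open UnitAddTorus in
theorem sum_mFourier_add_nsmul (m : ι → ℤ) (h : UnitAddTorus ι) {y : UnitAddTorus ι}
    (hy : ∑ j, m j • y j ≠ 0) :
    ∑ k ∈ range (addOrderOf y), mFourier m (h + k • y) = 0 := by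
  have hpow (k : ℕ) : mFourier m (h + k • y) = mFourier m h * mFourier m y ^ k := by
    simp only [mFourier_eq_toCircle, Pi.add_apply, Pi.smul_apply, smul_add, sum_add_distrib,
      smul_comm _ k, ← smul_sum, AddCircle.toCircle_add, AddCircle.toCircle_nsmul, Circle.coe_mul,
      Circle.coe_pow]
  have hroot : mFourier m y ^ addOrderOf y = 1 := by
    rw [mFourier_eq_toCircle, ← Circle.coe_pow, ← AddCircle.toCircle_nsmul, smul_sum]
    have hyj (j : ι) : addOrderOf y • y j = 0 := congrFun (addOrderOf_nsmul_eq_zero y) j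
    simp [smul_comm (addOrderOf y), hyj]
  have hne : mFourier m y ≠ 1 := fun h1 ↦ hy <| AddCircle.injective_toCircle one_ne_zero <| by
    rw [AddCircle.toCircle_zero]
    exact Circle.coe_injective (by rw [← mFourier_eq_toCircle, h1, Circle.coe_one])
  rw [sum_congr rfl fun k _ ↦ hpow k, ← mul_sum, geom_sum_eq hne, hroot, sub_self, zero_div,
    mul_zero]

open UnitAddTorus in
theorem eventually_sum_add_nsmul_eq {h : UnitAddTorus ι} (hh : h ∈ annihilator (relations U x))
    {p : C(UnitAddTorus ι, ℂ)} (hp : p ∈ Submodule.span ℂ (Set.range mFourier)) :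
    ∀ᶠ a in U, ∑ k ∈ range (addOrderOf (x a)), p (h + k • x a)
      = ∑ k ∈ range (addOrderOf (x a)), p (k • x a) := by
  induction hp using Submodule.span_induction with
  | mem p hp =>
    obtain ⟨m, rfl⟩ := hp
    by_cases hm : m ∈ relations U x
    · refine .of_forall fun a ↦ sum_congr rfl fun k _ ↦ ?_
      simp only [mFourier_eq_toCircle, Pi.add_apply, smul_add, sum_add_distrib, hh m hm, zero_add]
    · filter_upwards [Ultrafilter.eventually_not.2 hm] with a ha
      simpa [sum_mFourier_add_nsmul m h ha] using (sum_mFourier_add_nsmul m 0 ha).symm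
  | zero => simp
  | add p q _ _ hp hq =>
    filter_upwards [hp, hq] with a hpa hqa
    simp [sum_add_distrib, hpa, hqa]
  | smul c p _ hp =>
    filter_upwards [hp] with a ha
    simp [← mul_sum, ha]

open UnitAddTorus in
theorem exists_mem_span_mFourier_abs_sub_re_lt (f : C(UnitAddTorus ι, ℝ)) {ε : ℝ} (hε : 0 < ε) :
    ∃ p ∈ Submodule.span ℂ (Set.range (mFourier (d := ι))), ∀ y, |f y - (p y).re| < ε := by
  have hdense : Complex.ofRealCLM.compLeftContinuous ℝ _ f ∈
      (Submodule.span ℂ (Set.range (mFourier (d := ι)))).topologicalClosure := by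
    rw [span_mFourier_closure_eq_top]
    trivial
  obtain ⟨p, hp, hdist⟩ := Metric.mem_closure_iff.1 hdense ε hε
  refine ⟨p, hp, fun y ↦ ?_⟩
  exact (Complex.abs_re_le_norm (f y - p y)).trans_lt
    ((dist_eq_norm (f y : ℂ) (p y)).symm.trans_lt
      ((ContinuousMap.dist_apply_le_dist y).trans_lt hdist))

/-- Kronecker's theorem. If `h` is not a limit of multiples, some continuous `f` separates the set
of limits from its translate by `h`. After replacing `f` by a trigonometric polynomial, its sums
over the cyclic group generated by `x a` and over the translate of that group by `h` agree. -/
theorem annihilator_relations_le_multiplesLimit (hx : ∀ a, IsOfFinAddOrder (x a)) :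
    annihilator (relations U x) ≤ multiplesLimit U x := by
  intro h hh
  by_contra hmem
  set K : Set (UnitAddTorus ι) := (multiplesLimit U x : Set (UnitAddTorus ι))
  have hK : IsClosed K := isClosed_multiplesLimit
  have hdisj : Disjoint K ((· - h) ⁻¹' K) := Set.disjoint_left.2 fun y hy hy' ↦
    hmem (by simpa using sub_mem (H := multiplesLimit U x) hy hy')
  obtain ⟨f, hf0, hf1, -⟩ := exists_continuous_zero_one_of_isClosed hK
    (hK.preimage (continuous_sub_right h)) hdisj
  have hW : {y | f y < 1 / 4 ∧ 3 / 4 < f (h + y)} ∈ 𝓝ˢ K := by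
    refine IsOpen.mem_nhdsSet ?_ |>.2 fun y hy ↦ ⟨?_, ?_⟩
    · exact (isOpen_lt f.continuous continuous_const).inter
        (isOpen_lt continuous_const (f.continuous.comp (continuous_const_add h)))
    · simp [hf0 hy]
    · have hfy : f (h + y) = 1 := hf1 (by rwa [Set.mem_preimage, add_sub_cancel_left])
      norm_num [hfy]
  obtain ⟨p, hp, hfp⟩ := exists_mem_span_mFourier_abs_sub_re_lt f (ε := 1 / 4) (by norm_num)
  obtain ⟨a, hsum, ha⟩ :=
    ((eventually_sum_add_nsmul_eq hh hp).and (eventually_forall_zsmul_mem hW)).exists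
  have hlt (k : ℕ) : (p (k • x a)).re < (p (h + k • x a)).re := by
    obtain ⟨h0, h1⟩ := ha k
    rw [natCast_zsmul] at h0 h1
    have h0' := abs_lt.1 (hfp (k • x a))
    have h1' := abs_lt.1 (hfp (h + k • x a))
    linarith [h0'.1, h1'.2]
  have hre := congrArg Complex.re hsum
  rw [Complex.re_sum, Complex.re_sum] at hre
  exact hre.not_gt (sum_lt_sum_of_nonempty
    (nonempty_range_iff.2 (hx a).addOrderOf_pos.ne') fun k _ ↦ hlt k)

end Kronecker

section TorsionCoordinates

variable {ι : Type*}

/-- The coordinate `j` has bounded order on the subgroup `A` of the torus, hence takes finitely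
many values there. -/
def IsTorsionCoord (A : AddSubgroup (UnitAddTorus ι)) (j : ι) : Prop :=
  ∃ N : ℕ, 0 < N ∧ ∀ y ∈ A, N • y j = 0

theorem continuousWithinAt_saw_apply {A : AddSubgroup (UnitAddTorus ι)} {h : UnitAddTorus ι}
    {j : ι} (hj : h j = 0 → IsTorsionCoord A j) :
    ContinuousWithinAt (fun y : UnitAddTorus ι ↦ saw (y j)) A h := by
  by_cases h0 : h j = 0
  · obtain ⟨N, hN, hA⟩ := hj h0
    have hclosed : IsClosed ({u : UnitAddCircle | N • u = 0} \ {0}) :=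
      ((AddCircle.finite_torsion 1 hN).subset Set.sdiff_subset).isClosed
    have hnhds : ∀ᶠ y in 𝓝 h, y j ∈ ({u : UnitAddCircle | N • u = 0} \ {0})ᶜ :=
      (continuous_apply j).continuousAt.eventually_mem
        (hclosed.isOpen_compl.mem_nhds (by simp [h0]))
    have hzero : ∀ᶠ y in 𝓝[A] h, saw (h j) = saw (y j) := by
      filter_upwards [nhdsWithin_le_nhds hnhds, self_mem_nhdsWithin] with y hy hyA
      rw [h0, of_not_not fun hne ↦ hy ⟨hA y hyA, hne⟩]
    exact tendsto_const_nhds.congr' hzero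
  · exact (ContinuousAt.comp' (f := fun y : UnitAddTorus ι ↦ y j) (continuousAt_saw h0)
      (continuous_apply j).continuousAt).continuousWithinAt

theorem exists_orthogonal_isTorsionCoord_of_eq_zero [Fintype ι] (Λ : Submodule ℤ (ι → ℤ)) :
    ∃ w : ι → ℤ, (∀ m ∈ Λ, ∑ j, m j * w j = 0) ∧
      ∀ j, w j = 0 → IsTorsionCoord (annihilator Λ) j := by
  classical
  let φ : (ι → ℤ) →ₗ[ℤ] TensorProduct ℤ ℚ ((ι → ℤ) ⧸ Λ) := TensorProduct.mk ℤ ℚ _ 1 ∘ₗ Λ.mkQ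
  have htors (j : ι) (hj : φ (Pi.single j 1) = 0) : IsTorsionCoord (annihilator Λ) j := by
    obtain ⟨c, hc⟩ := (IsLocalizedModule.eq_zero_iff (nonZeroDivisors ℤ)
      (TensorProduct.mk ℤ ℚ ((ι → ℤ) ⧸ Λ) 1)).1 hj
    have hmem : Pi.single j (c : ℤ) ∈ Λ := by
      rw [Submonoid.smul_def, ← map_smul, ← Pi.single_smul, smul_eq_mul, mul_one] at hc
      exact (Submodule.Quotient.mk_eq_zero Λ).1 hc
    refine ⟨(c : ℤ).natAbs, Int.natAbs_pos.2 (nonZeroDivisors.coe_ne_zero c), fun y hy ↦ ?_⟩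
    simpa [Pi.single_apply, natAbs_nsmul_eq_zero] using hy _ hmem
  obtain ⟨f, hf⟩ := Module.exists_dual_forall_apply_ne_zero (K := ℚ)
    (fun j : {j // φ (Pi.single j 1) ≠ 0} ↦ φ (Pi.single j 1)) fun j ↦ j.2
  obtain ⟨d, hd⟩ := IsLocalization.exist_integer_multiples_of_finite (nonZeroDivisors ℤ)
    fun j ↦ f (φ (Pi.single j 1))
  choose w hw using hd
  refine ⟨w, fun m hm ↦ ?_, fun j hj ↦ htors j ?_⟩
  · have hφ : φ m = 0 :=
      (congrArg (TensorProduct.mk ℤ ℚ _ 1) ((Submodule.Quotient.mk_eq_zero Λ).2 hm)).trans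
        (map_zero _)
    have hsum : m = ∑ j, m j • Pi.single j (1 : ℤ) := by
      simp [← Pi.single_smul, Finset.univ_sum_single]
    have h : ((∑ j, m j * w j : ℤ) : ℚ) = (d : ℤ) • f (φ m) := by
      conv_rhs => rw [hsum]
      simp only [map_sum, map_zsmul, smul_sum, smul_comm (d : ℤ), ← hw]
      simp
    rw [hφ, map_zero, smul_zero] at h
    exact_mod_cast h
  · by_contra hne
    refine hf ⟨j, hne⟩ ?_
    simpa [hj] using hw j

end TorsionCoordinates

section Nonneg

theorem eventually_add_coe_ne_zero (x : UnitAddCircle) : ∀ᶠ t : ℝ in 𝓝[≠] 0, x + t ≠ 0 := by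
  obtain rfl | hx := eq_or_ne x 0
  · filter_upwards [self_mem_nhdsWithin, nhdsWithin_le_nhds (Ioo_mem_nhds neg_one_lt_zero one_pos)]
      with t ht0 ht
    rw [zero_add, Ne, AddCircle.coe_eq_zero_iff]
    rintro ⟨n, rfl⟩
    rw [zsmul_one] at ht ht0
    have hlt : n < 1 := by exact_mod_cast ht.2
    have hgt : -1 < n := by exact_mod_cast ht.1
    exact ht0 (by simp [show n = 0 by omega])
  · have h : Tendsto (fun t : ℝ ↦ x + t) (𝓝 0) (𝓝 x) :=
      (continuous_const.add (AddCircle.continuous_mk' 1)).tendsto' 0 x (add_zero x)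
    exact nhdsWithin_le_nhds (h.eventually_ne hx)

variable {α ι : Type*}

/-- The one-parameter subgroup of the torus with integral direction `w`. -/
def windingHom (w : ι → ℤ) : UnitAddCircle →+ UnitAddTorus ι :=
  AddMonoidHom.pi fun j ↦ zsmulAddGroupHom (w j)

@[simp]
theorem windingHom_apply (w : ι → ℤ) (s : UnitAddCircle) (j : ι) : windingHom w s j = w j • s :=
  rfl

theorem eventually_isTorsionCoord_of_add_windingHom_eq_zero [Finite ι]
    {A : AddSubgroup (UnitAddTorus ι)} {w : ι → ℤ} (hw : ∀ j, w j = 0 → IsTorsionCoord A j)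
    (h : UnitAddTorus ι) :
    ∀ᶠ t : ℝ in 𝓝[≠] 0, ∀ j, (h + windingHom w t) j = 0 → IsTorsionCoord A j := by
  refine eventually_all.2 fun j ↦ ?_
  by_cases hj : w j = 0
  · exact .of_forall fun _ _ ↦ hw j hj
  · have hmul : Tendsto (fun t : ℝ ↦ w j • t) (𝓝[≠] 0) (𝓝[≠] 0) := by
      refine tendsto_nhdsWithin_iff.2 ⟨?_, ?_⟩
      · exact ((continuous_const_smul _).tendsto' 0 0 (smul_zero _)).mono_left nhdsWithin_le_nhds
      · filter_upwards [self_mem_nhdsWithin] with t ht using smul_ne_zero hj ht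
    filter_upwards [hmul.eventually (eventually_add_coe_ne_zero (h j))] with t ht h0
    exact absurd h0 ht

variable [Fintype ι]

theorem windingHom_mem_annihilator {Λ : Submodule ℤ (ι → ℤ)} {w : ι → ℤ}
    (hw : ∀ m ∈ Λ, ∑ j, m j * w j = 0) (s : UnitAddCircle) : windingHom w s ∈ annihilator Λ :=
  fun m hm ↦ by simp only [windingHom_apply, ← mul_smul, ← sum_smul, hw m hm, zero_smul]

/-- The sum of the sawtooths of the coordinates. -/
noncomputable def sawSum (y : UnitAddTorus ι) : ℝ := ∑ j, saw (y j)

theorem sawSum_neg (y : UnitAddTorus ι) : sawSum (-y) = -sawSum y := by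
  simp [sawSum, saw_neg]

theorem eventually_sawSum_add_add_sawSum_sub (h : UnitAddTorus ι) (w : ι → ℤ) :
    ∀ᶠ t : ℝ in 𝓝 0,
      sawSum (h + windingHom w t) + sawSum (h - windingHom w t) = 2 * sawSum h := by
  have hj (j : ι) : ∀ᶠ t : ℝ in 𝓝 0,
      saw (h j + w j • (t : UnitAddCircle)) + saw (h j - w j • (t : UnitAddCircle))
        = 2 * saw (h j) :=
    ((continuous_const_smul (w j)).tendsto' (0 : ℝ) 0 (smul_zero _)).eventually
      (eventually_saw_add_add_saw_sub (h j))
  filter_upwards [eventually_all.2 hj] with t ht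
  simp only [sawSum, Pi.add_apply, Pi.sub_apply, windingHom_apply, ← sum_add_distrib, ht, mul_sum]

variable {U : Ultrafilter α} {x : α → UnitAddTorus ι} {T : Set UnitAddCircle} {o : ι}

theorem sawSum_nonneg_of_forall_isTorsionCoord (hT : IsOpen T) (hx : ∀ a, IsOfFinAddOrder (x a))
    (hnonneg : ∀ a (k : ℤ), (k • x a) o ∈ T → 0 ≤ sawSum (k • x a)) {h : UnitAddTorus ι}
    (hh : h ∈ annihilator (relations U x)) (ho : h o ∈ T)
    (hgen : ∀ j, h j = 0 → IsTorsionCoord (annihilator (relations U x)) j) : 0 ≤ sawSum h := by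
  have hcont : ContinuousWithinAt sawSum (annihilator (relations U x)) h :=
    tendsto_finsetSum _ fun j _ ↦ continuousWithinAt_saw_apply (hgen j)
  by_contra! hneg
  have hV := mem_nhdsWithin_iff_eventually.1 (hcont.eventually_lt_const hneg)
  have hVT := hV.and ((continuous_apply o).continuousAt.eventually_mem (hT.mem_nhds ho))
  have hann : ∀ᶠ a in U, x a ∈ annihilator (relations U x) := eventually_mem_annihilator_relations
  obtain ⟨a, ⟨k, hk, hkT⟩, ha⟩ :=
    ((annihilator_relations_le_multiplesLimit hx hh _ hVT).and hann).exists
  exact (hnonneg a k hkT).not_gt (hk (zsmul_mem ha k))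

/-- At the jumps of `sawSum` its value is the mean of the two one-sided limits, so it suffices to
perturb `h` in both directions along a line on which `sawSum` is continuous. -/
theorem sawSum_nonneg_of_mem_annihilator (hT : IsOpen T) (hx : ∀ a, IsOfFinAddOrder (x a))
    (hnonneg : ∀ a (k : ℤ), (k • x a) o ∈ T → 0 ≤ sawSum (k • x a)) {h : UnitAddTorus ι}
    (hh : h ∈ annihilator (relations U x)) (ho : h o ∈ T) : 0 ≤ sawSum h := by
  obtain ⟨w, hw, hgen⟩ := exists_orthogonal_isTorsionCoord_of_eq_zero (relations U x)
  have hpos : ∀ᶠ t : ℝ in 𝓝[≠] 0, 0 ≤ sawSum (h + windingHom w t) := by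
    have hcont : Tendsto (fun t : ℝ ↦ (h + windingHom w t) o) (𝓝 0) (𝓝 (h o)) :=
      (continuous_const.add ((continuous_zsmul (w o)).comp (AddCircle.continuous_mk' 1))).tendsto'
        _ _ (by simp)
    filter_upwards [eventually_isTorsionCoord_of_add_windingHom_eq_zero hgen h,
      nhdsWithin_le_nhds (hcont.eventually_mem (hT.mem_nhds ho))] with t ht htT
    exact sawSum_nonneg_of_forall_isTorsionCoord hT hx hnonneg
      (add_mem hh (windingHom_mem_annihilator hw _)) htT ht
  have hneg : Tendsto (fun t : ℝ ↦ -t) (𝓝[≠] 0) (𝓝[≠] 0) :=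
    (neg_nhdsNE.trans (by rw [neg_zero])).le
  obtain ⟨t, ht, ht', hsum⟩ := (hpos.and ((hneg.eventually hpos).and
    (nhdsWithin_le_nhds (eventually_sawSum_add_add_sawSum_sub h w)))).exists
  rw [AddCircle.coe_neg, map_neg, ← sub_eq_add_neg] at ht'
  linarith

end Nonneg

section Averaging

variable {ι : Type*}

theorem dvd_of_forall_zsmul_eq_zero {m W : ℤ} (hW : W ≠ 0)
    (h : ∀ s : UnitAddCircle, W • s = 0 → m • s = 0) : W ∣ m := by
  have hW' : (W : ℝ) ≠ 0 := Int.cast_ne_zero.2 hW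
  have hs : W • ((1 / W : ℝ) : UnitAddCircle) = 0 := by
    rw [← AddCircle.coe_zsmul, zsmul_eq_mul, mul_one_div_cancel hW', AddCircle.coe_period]
  obtain ⟨q, hq⟩ := (AddCircle.coe_eq_zero_iff _).1 ((AddCircle.coe_zsmul _).trans (h _ hs))
  refine ⟨q, ?_⟩
  rw [zsmul_one, zsmul_eq_mul, mul_one_div, eq_div_iff hW'] at hq
  rw [mul_comm]
  exact_mod_cast hq.symm

theorem saw_zsmul (q : ℤ) (u : UnitAddCircle) : saw (q • u) = q.sign * saw (q.natAbs • u) := by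
  obtain hq | rfl | hq := lt_trichotomy q 0
  · have h : q • u = -(q.natAbs • u) := by
      rw [← natCast_zsmul, Int.ofNat_natAbs_of_nonpos hq.le, neg_smul, neg_neg]
    simp [h, saw_neg, Int.sign_eq_neg_one_of_neg hq]
  · simp
  · have h : q • u = q.natAbs • u := by
      rw [← natCast_zsmul, Int.natAbs_of_nonneg hq.le]
    simp [h, Int.sign_eq_one_of_pos hq]

theorem exists_sum_saw_windingHom_add_apply_eq {A : AddSubgroup (UnitAddTorus ι)} [Fintype A]
    {w : ι → ℤ} {W : ℤ} (hW : W ≠ 0) (hA : ∀ s, W • s = 0 → windingHom w s ∈ A) (j : ι) :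
    ∃ (D : ℝ) (P : ℕ), ∀ s, ∑ a : A, saw (w j • s + a.1 j) = D * saw (P • W • s) := by
  let f : A →+ UnitAddCircle := (Pi.evalAddMonoidHom _ j).comp A.subtype
  obtain ⟨q, hq⟩ : W ∣ Nat.card f.range * w j := dvd_of_forall_zsmul_eq_zero hW fun s hs ↦ by
    rw [mul_smul, natCast_zsmul, card_nsmul_eq_zero_iff_mem]
    exact ⟨⟨_, hA s hs⟩, rfl⟩
  refine ⟨Nat.card f.ker * q.sign, q.natAbs, fun s ↦ ?_⟩
  rw [mul_assoc, ← saw_zsmul, smul_smul, mul_comm q, ← hq, mul_smul, natCast_zsmul]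
  exact sum_saw_add_apply f _

theorem finite_setOf_zsmul_eq_zero [Finite ι] {N : ℤ} (hN : N ≠ 0) :
    {y : UnitAddTorus ι | N • y = 0}.Finite :=
  (Set.Finite.pi' fun _ ↦ AddCircle.finite_torsion 1 (Int.natAbs_pos.2 hN)).subset
    fun _ hy j ↦ natAbs_nsmul_eq_zero.2 (congrFun hy j)

variable [Fintype ι]

theorem exists_sum_sawSum_windingHom_add_eq {A : AddSubgroup (UnitAddTorus ι)} [Fintype A]
    {w : ι → ℤ} {W : ℤ} (hW : W ≠ 0) (hA : ∀ s, W • s = 0 → windingHom w s ∈ A) :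
    ∃ (D : ι → ℝ) (P : ι → ℕ), ∀ s,
      ∑ a : A, sawSum (windingHom w s + a.1) = ∑ j, D j * saw (P j • W • s) := by
  choose D P h using exists_sum_saw_windingHom_add_apply_eq hW hA
  refine ⟨D, P, fun s ↦ ?_⟩
  simp only [← h]
  exact sum_comm

variable {H : AddSubgroup (UnitAddTorus ι)} {w : ι → ℤ} {o : ι} {T : Set UnitAddCircle}

theorem sum_sawSum_windingHom_add_eq_zero {A : AddSubgroup (UnitAddTorus ι)} [Fintype A]
    (hAH : A ≤ H) (hAo : ∀ a ∈ A, a o = 0) (hA : ∀ s, w o • s = 0 → windingHom w s ∈ A)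
    (hw : ∀ s, windingHom w s ∈ H) (ho : w o ≠ 0) (hT : IsOpen T)
    (hmid : ∀ t ∈ Set.Icc (1 / 6 : ℝ) (5 / 6), (t : UnitAddCircle) ∈ T)
    (hnonneg : ∀ h ∈ H, h o ∈ T → 0 ≤ sawSum h) (s : UnitAddCircle) :
    ∑ a : A, sawSum (windingHom w s + a.1) = 0 := by
  obtain ⟨D, P, hDP⟩ := exists_sum_sawSum_windingHom_add_eq ho hA
  rw [hDP]
  refine sum_saw_nsmul_eq_zero_of_middle (hT.inter hT.neg) (fun t ht ↦ ⟨hmid t ht, ?_⟩)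
    (fun u hu ↦ ?_) _
  · rw [Set.mem_neg, neg_coe_eq_coe_one_sub]
    exact hmid _ ⟨by linarith [ht.2], by linarith [ht.1]⟩
  · obtain ⟨s, rfl⟩ := DivisibleBy.surjective_smul UnitAddCircle ℤ ho u
    rw [← hDP]
    refine sum_eq_zero fun a _ ↦ le_antisymm ?_ ?_
    · have h := hnonneg (-(windingHom w s + a)) (neg_mem (add_mem (hw s) (hAH a.2)))
        (by simpa [hAo a a.2] using hu.2)
      rw [sawSum_neg] at h
      linarith
    · exact hnonneg _ (add_mem (hw s) (hAH a.2)) (by simpa [hAo a a.2] using hu.1)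

/-- Where `h o` and `-h o` both lie in `T`, oddness turns nonnegativity into vanishing. Averaging
over a finite group of translations turns `sawSum` on a line into a combination of `saw (P j • s)`,
which vanishes identically once it does so in the middle of the circle. -/
theorem sawSum_eq_zero_of_forall_nonneg (hw : ∀ s, windingHom w s ∈ H) (ho : w o ≠ 0)
    (hT : IsOpen T) (hmid : ∀ t ∈ Set.Icc (1 / 6 : ℝ) (5 / 6), (t : UnitAddCircle) ∈ T)
    (hnonneg : ∀ h ∈ H, h o ∈ T → 0 ≤ sawSum h) {b : UnitAddTorus ι} (hb : b ∈ H)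
    (hfin : IsOfFinAddOrder b) (hbT : b o ∈ T) : sawSum b = 0 := by
  obtain ⟨s, hs : w o • s = b o⟩ := DivisibleBy.surjective_smul UnitAddCircle ℤ ho (b o)
  obtain ⟨M, hM, hMb⟩ := isOfFinAddOrder_iff_zsmul_eq_zero.1 hfin
  let A : AddSubgroup (UnitAddTorus ι) :=
    H ⊓ (Pi.evalAddMonoidHom _ o).ker ⊓ (zsmulAddGroupHom (M * w o)).ker
  have : Fintype A :=
    ((finite_setOf_zsmul_eq_zero (mul_ne_zero hM ho)).subset fun a ha ↦ ha.2).fintype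
  have hA (u : UnitAddCircle) (hu : w o • u = 0) : windingHom w u ∈ A := by
    refine ⟨⟨hw u, hu⟩, ?_⟩
    change (M * w o) • windingHom w u = 0
    rw [← map_zsmul, mul_smul, hu, smul_zero, map_zero]
  have hsum := sum_sawSum_windingHom_add_eq_zero (A := A) (fun a ha ↦ ha.1.1) (fun a ha ↦ ha.1.2)
    hA hw ho hT hmid hnonneg s
  have hterm (a : A) : 0 ≤ sawSum (windingHom w s + a.1) := by
    refine hnonneg _ (add_mem (hw s) a.2.1.1) ?_
    rwa [Pi.add_apply, show a.1 o = 0 from a.2.1.2, add_zero, windingHom_apply, hs]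
  have hbA : b - windingHom w s ∈ A := by
    refine ⟨⟨H.sub_mem hb (hw s), show b o - w o • s = 0 by rw [hs, sub_self]⟩, ?_⟩
    have hsM : (M * w o) • windingHom w s = 0 := by
      rw [← map_zsmul, mul_smul, hs, ← Pi.smul_apply, hMb, Pi.zero_apply, map_zero]
    change (M * w o) • (b - windingHom w s) = 0
    rw [smul_sub, hsM, sub_zero, mul_comm, mul_smul, hMb, smul_zero]
  have h := (sum_eq_zero_iff_of_nonneg fun a _ ↦ hterm a).1 hsum ⟨_, hbA⟩ (mem_univ _)
  rwa [add_sub_cancel] at h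

theorem exists_forall_sawSum_eq_zero (hT : IsOpen T)
    (hmid : ∀ t ∈ Set.Icc (1 / 6 : ℝ) (5 / 6), (t : UnitAddCircle) ∈ T) (o : ι) :
    ∃ R : ℕ, ∀ x : UnitAddTorus ι, IsOfFinAddOrder x → R < addOrderOf (x o) →
      (∀ k : ℤ, (k • x) o ∈ T → 0 ≤ sawSum (k • x)) →
        ∀ k : ℤ, (k • x) o ∈ T → sawSum (k • x) = 0 := by
  by_contra! hcon
  choose x hfin hord hnonneg k hkT hk using hcon
  let U : Ultrafilter ℕ := hyperfilter ℕ
  have hann : ∀ᶠ n in U, x n ∈ annihilator (relations U x) := eventually_mem_annihilator_relations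
  obtain ⟨w, hw, hwtors⟩ := exists_orthogonal_isTorsionCoord_of_eq_zero (relations U x)
  have ho : w o ≠ 0 := by
    intro h0
    obtain ⟨N, hN, hNtors⟩ := hwtors o h0
    have hlarge : ∀ᶠ n in U, N ≤ n := Nat.hyperfilter_le_atTop (eventually_ge_atTop N)
    obtain ⟨n, hn, hNn⟩ := (hann.and hlarge).exists
    have := addOrderOf_le_of_nsmul_eq_zero hN (hNtors _ hn)
    exact absurd (hord n) (by omega)
  obtain ⟨n, hn⟩ := hann.exists
  refine hk n (sawSum_eq_zero_of_forall_nonneg (windingHom_mem_annihilator hw) ho hT hmid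
    (fun h hh ↦ sawSum_nonneg_of_mem_annihilator hT hfin hnonneg hh) (zsmul_mem hn (k n))
    (hfin n).zsmul (hkT n))

end Averaging

section Weights

theorem coe_mul_div_eq_zero_iff_dvd {r : ℕ} (hr : 0 < r) (a : ℤ) (k : ℕ) :
    ((a * k / r : ℝ) : UnitAddCircle) = 0 ↔ (r : ℤ) ∣ a * k := by
  have hr' : (r : ℝ) ≠ 0 := by positivity
  simp only [AddCircle.coe_eq_zero_iff, zsmul_one, eq_div_iff hr', Dvd.dvd]
  refine exists_congr fun q ↦ ?_
  rw [eq_comm, mul_comm (q : ℝ)]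
  norm_cast

theorem saw_coe_mul_div_of_gcd_eq_one {r k : ℕ} {a : ℤ} (ha : Int.gcd a r = 1) (hk : 0 < k)
    (hkr : k < r) :
    saw ((a * k / r : ℝ) : UnitAddCircle) = Int.fract ((a * k : ℝ) / r) - 1 / 2 := by
  refine saw_coe fun h ↦ ?_
  rw [coe_mul_div_eq_zero_iff_dvd (hk.trans hkr)] at h
  have hdvd := (Int.isCoprime_iff_gcd_eq_one.2 ha).symm.dvd_of_dvd_mul_left h
  exact (Nat.le_of_dvd hk (by exact_mod_cast hdvd)).not_gt hkr

theorem dvd_mul_iff_of_gcd_eq {a b r : ℤ} (h : Int.gcd a r = Int.gcd b r) (k : ℤ) :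
    r ∣ a * k ↔ r ∣ b * k := by
  rw [← Int.dvd_gcd_mul_iff_dvd_mul, Int.gcd_comm, h, Int.gcd_comm, Int.dvd_gcd_mul_iff_dvd_mul]

theorem saw_coe_sub_saw_coe_of_gcd_eq {r : ℕ} {a b : ℤ} (hr : 0 < r)
    (h : Int.gcd a r = Int.gcd b r) (k : ℕ) :
    saw ((a * k / r : ℝ) : UnitAddCircle) - saw ((b * k / r : ℝ) : UnitAddCircle)
      = Int.fract ((a * k : ℝ) / r) - Int.fract ((b * k : ℝ) / r) := by
  have hiff : ((a * k / r : ℝ) : UnitAddCircle) = 0 ↔ ((b * k / r : ℝ) : UnitAddCircle) = 0 := by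
    simp only [coe_mul_div_eq_zero_iff_dvd hr, dvd_mul_iff_of_gcd_eq h]
  by_cases ha : ((a * k / r : ℝ) : UnitAddCircle) = 0
  · have hfract {t : ℝ} (ht : (t : UnitAddCircle) = 0) : Int.fract t = 0 := by
      obtain ⟨n, rfl⟩ := (AddCircle.coe_eq_zero_iff _).1 ht
      simp
    rw [ha, hiff.1 ha, hfract ha, hfract (hiff.1 ha), sub_self, sub_self]
  · rw [saw_coe ha, saw_coe (hiff.not.1 ha)]
    ring

/-- The point `(a₁, a₂, a₃, a₄, -e, -1) / r` of the torus. -/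
noncomputable def weightPoint (r : ℕ) (a₁ a₂ a₃ a₄ e : ℤ) : UnitAddTorus (Fin 6) :=
  fun j ↦ (((![a₁, a₂, a₃, a₄, -e, -1] j : ℤ) / r : ℝ) : UnitAddCircle)

/-- The difference between the two sides of the equation that defines `Γ`. -/
noncomputable def excess (r : ℕ) (a₁ a₂ a₃ a₄ e : ℤ) (k : ℕ) : ℝ :=
  Int.fract ((a₁ * k : ℝ) / r) + Int.fract ((a₂ * k : ℝ) / r) + Int.fract ((a₃ * k : ℝ) / r)
    + Int.fract ((a₄ * k : ℝ) / r) - Int.fract ((e * k : ℝ) / r) - k / r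

variable {r : ℕ} {a₁ a₂ a₃ a₄ e : ℤ}

theorem exists_int_excess_eq (hr : 0 < r) (hs : a₁ + a₂ + a₃ + a₄ - e ≡ 1 [ZMOD r]) (k : ℕ) :
    ∃ z : ℤ, excess r a₁ a₂ a₃ a₄ e k = z := by
  obtain ⟨l, hl⟩ := hs.symm.dvd
  have hsum : (a₁ * k : ℝ) / r + a₂ * k / r + a₃ * k / r + a₄ * k / r - e * k / r - k / r
      = l * k := by
    have hl' : (a₁ + a₂ + a₃ + a₄ - e - 1 : ℝ) = r * l := by exact_mod_cast hl
    field_simp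
    rw [hl', mul_assoc]
  refine ⟨l * k - ⌊(a₁ * k : ℝ) / r⌋ - ⌊(a₂ * k : ℝ) / r⌋ - ⌊(a₃ * k : ℝ) / r⌋
    - ⌊(a₄ * k : ℝ) / r⌋ + ⌊(e * k : ℝ) / r⌋, ?_⟩
  simp only [excess, Int.fract]
  push_cast
  linarith

theorem nsmul_weightPoint_self (hr : 0 < r) : r • weightPoint r a₁ a₂ a₃ a₄ e = 0 := by
  funext j
  rw [Pi.smul_apply, weightPoint, ← AddCircle.coe_nsmul, nsmul_eq_mul,
    mul_div_cancel₀ _ (by positivity), Pi.zero_apply, AddCircle.coe_eq_zero_iff]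
  exact ⟨_, zsmul_one _⟩

theorem isOfFinAddOrder_weightPoint (hr : 0 < r) :
    IsOfFinAddOrder (weightPoint r a₁ a₂ a₃ a₄ e) :=
  isOfFinAddOrder_iff_nsmul_eq_zero.2 ⟨r, hr, nsmul_weightPoint_self hr⟩

theorem weightPoint_five : weightPoint r a₁ a₂ a₃ a₄ e 5 = -((1 / r : ℝ) : UnitAddCircle) := by
  simp [weightPoint, neg_div]

theorem addOrderOf_weightPoint_five (hr : 0 < r) :
    addOrderOf (weightPoint r a₁ a₂ a₃ a₄ e 5) = r := by
  rw [weightPoint_five, addOrderOf_neg, AddCircle.addOrderOf_period_div hr]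

theorem nsmul_weightPoint_five (k : ℕ) :
    (k • weightPoint r a₁ a₂ a₃ a₄ e) 5 = -((k / r : ℝ) : UnitAddCircle) := by
  rw [Pi.smul_apply, weightPoint_five, smul_neg, ← AddCircle.coe_nsmul, nsmul_eq_mul, mul_one_div]

theorem exists_lt_nsmul_weightPoint_eq_zsmul (hr : 0 < r) (k : ℤ) :
    ∃ l < r, l • weightPoint r a₁ a₂ a₃ a₄ e = k • weightPoint r a₁ a₂ a₃ a₄ e := by
  have hr' : (0 : ℤ) < r := by exact_mod_cast hr
  have hnonneg := Int.emod_nonneg k hr'.ne'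
  have hlt := Int.emod_lt_of_pos k hr'
  refine ⟨(k % r).toNat, by omega, ?_⟩
  conv_rhs => rw [← Int.emod_add_mul_ediv k r, add_smul, mul_comm, mul_smul, natCast_zsmul,
    nsmul_weightPoint_self hr, smul_zero, add_zero]
  rw [← natCast_zsmul, Int.toNat_of_nonneg hnonneg]

theorem sawSum_nsmul_weightPoint {k : ℕ} (h₁ : Int.gcd a₁ r = 1) (h₂ : Int.gcd a₂ r = 1)
    (h₃ : Int.gcd a₃ r = 1) (h₄ : Int.gcd a₄ r = Int.gcd e r) (hk : 0 < k) (hkr : k < r) :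
    sawSum (k • weightPoint r a₁ a₂ a₃ a₄ e) = excess r a₁ a₂ a₃ a₄ e k - 1 := by
  have hr : 0 < r := hk.trans hkr
  have hpair := saw_coe_sub_saw_coe_of_gcd_eq hr h₄ k
  have hlast : saw ((k / r : ℝ) : UnitAddCircle) = k / r - 1 / 2 :=
    saw_coe_of_mem_Ioo ⟨by positivity, (div_lt_one (by positivity)).2 (by exact_mod_cast hkr)⟩
  have hcoord (a : ℤ) : k • ((a / r : ℝ) : UnitAddCircle) = ((a * k / r : ℝ) : UnitAddCircle) := by
    rw [← AddCircle.coe_nsmul, nsmul_eq_mul, mul_comm, div_mul_eq_mul_div]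
  have hneg : (((-e : ℤ) * k / r : ℝ) : UnitAddCircle) = -((e * k / r : ℝ) : UnitAddCircle) := by
    rw [Int.cast_neg, neg_mul, neg_div, AddCircle.coe_neg]
  rw [sawSum, Fin.sum_univ_six, nsmul_weightPoint_five]
  simp only [Pi.smul_apply, weightPoint, Matrix.cons_val, hcoord, hneg, saw_neg, hlast, excess,
    saw_coe_mul_div_of_gcd_eq_one h₁ hk hkr, saw_coe_mul_div_of_gcd_eq_one h₂ hk hkr,
    saw_coe_mul_div_of_gcd_eq_one h₃ hk hkr]
  linarith

end Weights

section Bound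

theorem isOpen_compl_image_coe_Icc (c : ℝ) :
    IsOpen ((↑) '' Set.Icc 0 c : Set UnitAddCircle)ᶜ :=
  (isCompact_Icc.image (AddCircle.continuous_mk' 1)).isClosed.isOpen_compl

theorem coe_mem_compl_image_coe_Icc_iff {c t : ℝ} (hc : c < 1) (ht : t ∈ Set.Ico 0 1) :
    (t : UnitAddCircle) ∈ ((↑) '' Set.Icc 0 c : Set UnitAddCircle)ᶜ ↔ c < t := by
  refine ⟨fun h ↦ lt_of_not_ge fun hle ↦ h ⟨t, ⟨ht.1, hle⟩, rfl⟩, ?_⟩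
  rintro h ⟨s, hs, hst⟩
  have hst' : s = t := (AddCircle.coe_eq_coe_iff_of_mem_Ico (a := (0 : ℝ)) (p := 1)
    ⟨hs.1, by linarith [hs.2]⟩ (by simpa using ht)).1 hst
  linarith [hs.2]

theorem exists_forall_excess_eq_one {ε : ℝ} (hε : 0 < ε) :
    ∃ R : ℕ, ∀ (r : ℕ) (a₁ a₂ a₃ a₄ e : ℤ), R < r →
      Int.gcd a₁ r = 1 → Int.gcd a₂ r = 1 → Int.gcd a₃ r = 1 → Int.gcd a₄ r = Int.gcd e r →
      a₁ + a₂ + a₃ + a₄ - e ≡ 1 [ZMOD r] →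
      (∀ k : ℕ, 0 < k → k < r → (k : ℝ) / r < 5 / 6 + ε → 0 < excess r a₁ a₂ a₃ a₄ e k) →
      ∀ k : ℕ, 0 < k → k < r → 1 / 6 - ε < (k : ℝ) / r → excess r a₁ a₂ a₃ a₄ e k = 1 := by
  have hT {t : ℝ} (ht : t ∈ Set.Ico 0 1) :=
    coe_mem_compl_image_coe_Icc_iff (c := 1 / 6 - ε) (by linarith) ht
  obtain ⟨R, hR⟩ := exists_forall_sawSum_eq_zero (isOpen_compl_image_coe_Icc (1 / 6 - ε))
    (fun t ht ↦ (hT ⟨by linarith [ht.1], by linarith [ht.2]⟩).2 (by linarith [ht.1])) (5 : Fin 6)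
  refine ⟨R, fun r a₁ a₂ a₃ a₄ e hRr h₁ h₂ h₃ h₄ hs hpos k hk hkr hklt ↦ ?_⟩
  have hr : 0 < r := hk.trans hkr
  set x := weightPoint r a₁ a₂ a₃ a₄ e
  have hlt_one {l : ℕ} (hl : l < r) : (l : ℝ) / r < 1 :=
    (div_lt_one (by positivity)).2 (by exact_mod_cast hl)
  have hnonneg (m : ℤ) (hm : (m • x) 5 ∈ ((↑) '' Set.Icc 0 (1 / 6 - ε) : Set UnitAddCircle)ᶜ) :
      0 ≤ sawSum (m • x) := by
    obtain ⟨l, hl, hlm⟩ := exists_lt_nsmul_weightPoint_eq_zsmul hr m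
    rw [← hlm] at hm ⊢
    obtain rfl | hl0 := l.eq_zero_or_pos
    · simp [sawSum]
    have hl0' : (0 : ℝ) < l / r := by positivity
    rw [nsmul_weightPoint_five, neg_coe_eq_coe_one_sub,
      hT ⟨by linarith [hlt_one hl], by linarith⟩] at hm
    have hexcess := hpos l hl0 hl (by linarith)
    obtain ⟨z, hz⟩ := exists_int_excess_eq hr hs l
    rw [sawSum_nsmul_weightPoint h₁ h₂ h₃ h₄ hl0 hl, sub_nonneg]
    rw [hz] at hexcess ⊢
    exact_mod_cast hexcess
  have hzero : sawSum (-(k • x)) = 0 := by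
    rw [← natCast_zsmul, ← neg_smul]
    refine hR x (isOfFinAddOrder_weightPoint hr) (by rwa [addOrderOf_weightPoint_five hr])
      hnonneg (-k) ?_
    rw [neg_smul, natCast_zsmul, Pi.neg_apply, nsmul_weightPoint_five, neg_neg,
      hT ⟨by positivity, hlt_one hkr⟩]
    exact hklt
  rw [sawSum_neg, sawSum_nsmul_weightPoint h₁ h₂ h₃ h₄ hk hkr] at hzero
  linarith

theorem mainTheorem3_general {ε : ℝ} (hε : 0 < ε) :
    ∃ R : ℕ, ∀ (r : ℕ) (a₁ a₂ a₃ a₄ e : ℤ),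
      Int.gcd a₁ r = 1 → Int.gcd a₂ r = 1 → Int.gcd a₃ r = 1 →
      Int.gcd a₄ r = Int.gcd e r →
      a₁ + a₂ + a₃ + a₄ - e ≡ 1 [ZMOD r] →
      ∀ Γ : Set ℕ, Γ.Nonempty → (∀ k ∈ Γ, 1 ≤ k ∧ k < r) →
        (∀ k ∈ Γ, (k : ℝ) / r ∈ Set.Ico (5 / 6 + ε) 1 ∧
          Int.fract ((a₁ * k : ℝ) / r) + Int.fract ((a₂ * k : ℝ) / r)
            + Int.fract ((a₃ * k : ℝ) / r) + Int.fract ((a₄ * k : ℝ) / r)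
            = Int.fract ((e * k : ℝ) / r) + (k : ℝ) / r) →
        (∀ k : ℕ, 1 ≤ k → k < r → k ∉ Γ →
          Int.fract ((a₁ * k : ℝ) / r) + Int.fract ((a₂ * k : ℝ) / r)
            + Int.fract ((a₃ * k : ℝ) / r) + Int.fract ((a₄ * k : ℝ) / r)
            > Int.fract ((e * k : ℝ) / r) + 1) →
        r ≤ R := by
  obtain ⟨R, hR⟩ := exists_forall_excess_eq_one hε
  refine ⟨R, fun r a₁ a₂ a₃ a₄ e h₁ h₂ h₃ h₄ hs Γ ⟨k, hk⟩ hΓr hΓ hΓc ↦ le_of_not_gt fun hlt ↦ ?_⟩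
  have hpos (l : ℕ) (hl : 0 < l) (hlr : l < r) (hlt : (l : ℝ) / r < 5 / 6 + ε) :
      0 < excess r a₁ a₂ a₃ a₄ e l := by
    have hlΓ : l ∉ Γ := fun h ↦ hlt.not_ge (hΓ l h).1.1
    have hl1 : (l : ℝ) / r < 1 :=
      (div_lt_one (by exact_mod_cast hl.trans hlr)).2 (by exact_mod_cast hlr)
    have := hΓc l hl hlr hlΓ
    rw [excess]
    linarith
  obtain ⟨⟨hk5, -⟩, hkeq⟩ := hΓ k hk
  have hone := hR r a₁ a₂ a₃ a₄ e hlt h₁ h₂ h₃ h₄ hs hpos k (hΓr k hk).1 (hΓr k hk).2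
    (by linarith)
  rw [excess] at hone
  linarith

end Bound

theorem mainTheorem3 (ε : ℝ) (hε : ε ∈ Set.Ioo (0 : ℝ) (1 / 6)) :
    ∃ (Γ₀ : Finset ℕ) (M : ℕ), (∀ n ∈ Γ₀, 0 < n) ∧ 0 < M ∧
      ∀ (r : ℕ) (a₁ a₂ a₃ a₄ e : ℤ), 0 < r →
        Int.gcd a₁ r = 1 → Int.gcd a₂ r = 1 → Int.gcd a₃ r = 1 →
        Int.gcd a₄ r = Int.gcd e r →
        a₁ + a₂ + a₃ + a₄ - e ≡ 1 [ZMOD r] →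
        (a₁ + a₂ - e ≡ 0 [ZMOD r] ∨
          2 * a₄ - e ≡ 0 [ZMOD r] ∨
          (2 * a₁ - e ≡ 0 [ZMOD r] ∧ Int.gcd a₄ r ≤ 2 ∧ Int.gcd e r ≤ 2)) →
        ∀ Γ : Set ℕ, Γ.Nonempty → (∀ k ∈ Γ, 1 ≤ k ∧ k < r) →
          (∀ k ∈ Γ, (k : ℝ) / r ∈ Set.Ico (5 / 6 + ε) 1 ∧
            Int.fract ((a₁ * k : ℝ) / r) + Int.fract ((a₂ * k : ℝ) / r)
              + Int.fract ((a₃ * k : ℝ) / r) + Int.fract ((a₄ * k : ℝ) / r)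
              = Int.fract ((e * k : ℝ) / r) + (k : ℝ) / r) →
          (∀ k : ℕ, 1 ≤ k → k < r → k ∉ Γ →
            Int.fract ((a₁ * k : ℝ) / r) + Int.fract ((a₂ * k : ℝ) / r)
              + Int.fract ((a₃ * k : ℝ) / r) + Int.fract ((a₄ * k : ℝ) / r)
              > Int.fract ((e * k : ℝ) / r) + 1) →
          r ∈ Γ₀ ∨
            ((2 * a₄ - e ≡ 0 [ZMOD r] ∧ ¬ (a₁ + a₂ - e ≡ 0 [ZMOD r])) ∧
              (7 ≤ Int.gcd e r ∧ Int.gcd e r ≤ M) ∧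
              ∀ k ∈ Γ, (r : ℤ) ∣ e * k) := by
  obtain ⟨R, hR⟩ := mainTheorem3_general hε.1
  refine ⟨Finset.Icc 1 R, 1, fun n hn ↦ (Finset.mem_Icc.1 hn).1, one_pos, ?_⟩
  intro r a₁ a₂ a₃ a₄ e hr h₁ h₂ h₃ h₄ hs _ Γ hne hΓr hΓ hΓc
  exact .inl (Finset.mem_Icc.2 ⟨hr, hR r a₁ a₂ a₃ a₄ e h₁ h₂ h₃ h₄ hs Γ hne hΓr hΓ hΓc⟩)
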